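/- Let $\mathbb{K}$ be a field and let $\mathcal{D}$ be a $\mathbb{K}$-linear triangulated category of finite type, i.e. $\sum_{i\in\mathbb{Z}}\dim_{\mathbb{K}}\mathrm{Hom}_{\mathcal{D}}(E,F[i])<\infty$ for all objects $E,F$. Write $\mathrm{Hom}^*_{\mathcal D}(E,F)=\bigoplus_{i}\mathrm{Hom}_{\mathcal D}(E,F[i])[-i]$. Assume that $\mathcal{D}$ has a split-generator, i.e. an object $G$ such that the smallest full triangulated subcategory containing $G$ and closed under direct summands is $\mathcal{D}$. For objects $E,F$ and $t\in\mathbb{R}$ let $\delta_t(E,F)\in[0,\infty]$ be $0$ if $F\cong 0$, and otherwise the infimum of $\sum_{i=1}^k e^{n_it}$ over all finite sequences of integers $n_1,\dots,n_k$ for which there are an object $F'$ and exact triangles $A_{i-1}\to A_i\to E[n_i]\to A_{i-1}[1]$ $(1\le i\le k)$ with $A_0=0$ and $A_k=F\oplus F'$. For an exact functor $\Phi:\mathcal{D}\to\mathcal{D}$ the categorical entropy is $h_t(\Phi)=\lim_{n\to\infty}\frac1n\log\delta_t(G,\Phi^nG)\in[-\infty,\infty)$, where $G$ is a split-generator. Let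 $E$ be a $d$-spherical object of $\mathcal{D}$, that is, $d>0$ is an integer, $\mathrm{Hom}^*_{\mathcal{D}}(E,E)\cong\mathbb{K}[h]/(h^2)$ as graded algebras with $\deg h=d$, and there is a functorial isomorphism $\mathrm{Hom}^*_{\mathcal{D}}(E,-)\cong\mathrm{Hom}^*_{\mathcal{D}}(-,E[d])^\vee$ of graded vector spaces. Let $T_E:\mathcal{D}\to\mathcal{D}$ be the spherical twist along $E$, or more generally any exact functor which acts on objects by $T_EF\cong\mathrm{Cone}\bigl(\mathrm{Hom}^*_{\mathcal{D}}(E,F)\otimes E\xrightarrow{\mathrm{ev}}F\bigr)$. Then for every $t\in\mathbb{R}$ the limit defining $h_t(T_E)$ exists and does not depend on the split-generator $G$, and $$(1-d)t\;\le\;h_t(T_E)\;\le\;\begin{cases}0 & (t\ge 0),\\ (1-d)t & (t\le 0).\end{cases}$$ If moreover $E^\perp=\{F\in\mathrm{Ob}(\mathcal{D})\mid \mathrm{Hom}^*_{\mathcal{D}}(E,F)=0\}$ contains a nonzero object, then $h_t(T_E)=0$ for all $t\ge 0$. -/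

import Mathlib

open CategoryTheory CategoryTheory.Limits CategoryTheory.Pretriangulated Filter Topology
open scoped ENNReal

noncomputable section

namespace SphericalEntropy

universe w v u

/-! ### Split-generators, categorical complexity, categorical entropy -/

section Entropy

variable {D : Type u} [Category.{v} D] [HasZeroObject D] [HasShift D ℤ] [Preadditive D]
  [∀ n : ℤ, (shiftFunctor D n).Additive] [Pretriangulated D]

/-- `G` is a split-generator: the smallest full triangulated subcategory containing `G` and
closed under direct summands (retracts) is the whole category. -/
def IsSplitGenerator (G : D) : Prop :=
  ∀ P : ObjectProperty D, P.IsTriangulated → P.IsStableUnderRetracts → P G → ∀ X : D, P X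

/-- `ConeDecomposition E [n₁, …, n_k] F`: there is a sequence of exact triangles
`A_{i-1} ⟶ A_i ⟶ E⟦n_i⟧ ⟶ A_{i-1}⟦1⟧` (`i = 1, …, k`) with `A_0 = 0` and `A_k = F`. -/
inductive ConeDecomposition (E : D) : List ℤ → D → Prop
  | zero (F : D) (hF : IsZero F) : ConeDecomposition E [] F
  | step (l : List ℤ) (n : ℤ) (A F : D) (hA : ConeDecomposition E l A)
      (f : A ⟶ F) (g : F ⟶ E⟦n⟧) (h : E⟦n⟧ ⟶ A⟦(1 : ℤ)⟧)
      (hT : Triangle.mk f g h ∈ distTriang D) : ConeDecomposition E (l ++ [n]) F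

open Classical in
/-- The categorical complexity `δ_t(E, F) ∈ [0, ∞]`: it is `0` if `F ≅ 0`, and otherwise the
infimum of `∑ exp (n_i t)` over all cone decompositions of objects of the form `F ⊞ F'` with
components `E⟦n₁⟧, …, E⟦n_k⟧` (the infimum of the empty set being `∞`). -/
def complexity (E F : D) (t : ℝ) : ℝ≥0∞ :=
  if IsZero F then 0
  else ⨅ (l : List ℤ) (F' : D) (_ : ConeDecomposition E l (F ⊞ F')),
    (l.map fun n : ℤ => ENNReal.ofReal (Real.exp ((n : ℝ) * t))).sum

/-- `h ∈ [-∞, ∞]` is the value at `t` of the categorical entropy of the endofunctor `Φ`: for every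
split-generator `G` the limit of `(1 / n) * log δ_t(G, Φⁿ G)` exists and equals `h`. -/
def HasEntropyAt (Φ : D ⥤ D) (t : ℝ) (h : EReal) : Prop :=
  ∀ G : D, IsSplitGenerator G →
    Tendsto (fun n : ℕ => ENNReal.log (complexity G (Φ.obj^[n] G) t) / (n : EReal))
      atTop (𝓝 h)

end Entropy

/-! ### Finite type, spherical objects and spherical twists -/

section Spherical

variable (K : Type w) [Field K] {D : Type u} [Category.{v} D] [HasZeroObject D] [HasShift D ℤ]
  [Preadditive D] [∀ n : ℤ, (shiftFunctor D n).Additive] [Pretriangulated D] [Linear K D]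

variable (D) in
/-- `D` is of finite type over `K`: for all objects `E` and `F`, the total dimension
`∑ i, dim Hom(E, F⟦i⟧)` is finite. -/
class IsFiniteType : Prop where
  finite_hom : ∀ (E F : D) (i : ℤ), Module.Finite K (E ⟶ F⟦i⟧)
  finite_support : ∀ E F : D, {i : ℤ | Module.finrank K (E ⟶ F⟦i⟧) ≠ 0}.Finite

/-- The degree `i` part of the graded algebra `K[h]/(h²)` with `deg h = d`. -/
def dualNumberDegree (d i : ℤ) : Submodule K (DualNumber K) where
  carrier := {x | (i ≠ 0 → x.fst = 0) ∧ (i ≠ d → x.snd = 0)}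
  add_mem' := by
    rintro x y ⟨hx, hx'⟩ ⟨hy, hy'⟩
    exact ⟨fun h => by simp [hx h, hy h], fun h => by simp [hx' h, hy' h]⟩
  zero_mem' := by simp
  smul_mem' := by
    rintro c x ⟨hx, hx'⟩
    exact ⟨fun h => by simp [hx h], fun h => by simp [hx' h]⟩

/-- `E` is a `d`-spherical object. -/
structure IsSpherical (E : D) (d : ℤ) : Prop where
  /-- The degree is positive. -/
  pos : 0 < d
  /-- There is an isomorphism of graded algebras between `Hom*(E, E)` (with the composition of
  shifted morphisms) and `K[h]/(h²)`, `deg h = d`, given degree by degree. -/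
  algebra_iso : ∃ φ : ∀ i : ℤ, ShiftedHom E E i →ₗ[K] DualNumber K,
    (∀ i, Function.Injective (φ i)) ∧
    (∀ i, LinearMap.range (φ i) = dualNumberDegree K d i) ∧
    φ 0 (ShiftedHom.mk₀ (0 : ℤ) rfl (𝟙 E)) = 1 ∧
    ∀ (a b c : ℤ) (f : ShiftedHom E E a) (g : ShiftedHom E E b) (h : b + a = c),
      φ c (f.comp g h) = φ a f * φ b g
  /-- There is a functorial isomorphism of graded vector spaces between `Hom*(E, F)` and
  the graded dual of `Hom*(F, E⟦d⟧)`, whose degree `i` part is the dual of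
  `Hom(F, E⟦d⟧⟦-i⟧)`. -/
  duality : ∃ ψ : ∀ (i : ℤ) (F : D), (E ⟶ F⟦i⟧) ≃ₗ[K] Module.Dual K (F ⟶ (E⟦d⟧)⟦-i⟧),
    ∀ (i : ℤ) (F F' : D) (g : F ⟶ F') (f : E ⟶ F⟦i⟧) (u : F' ⟶ (E⟦d⟧)⟦-i⟧),
      ψ i F' (f ≫ g⟦i⟧') u = ψ i F f (g ≫ u)

/-- Index set of a homogeneous basis of `Hom*(E, F)`: pairs of a degree `i` and the
number of a vector in a basis of `Hom(E, F⟦i⟧)`. -/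
abbrev HomIndex (E F : D) : Type := Σ i : ℤ, Fin (Module.finrank K (E ⟶ F⟦i⟧))

instance finite_homIndex [IsFiniteType K D] (E F : D) : Finite (HomIndex K E F) := by
  have := (IsFiniteType.finite_support (K := K) E F).to_subtype
  refine Finite.of_injective
    (β := Σ i : {i : ℤ | Module.finrank K (E ⟶ F⟦i⟧) ≠ 0},
      Fin (Module.finrank K (E ⟶ F⟦i.1⟧)))
    (fun x => ⟨⟨x.1, fun h => absurd x.2.isLt (by omega)⟩, x.2⟩) ?_
  rintro ⟨i, a⟩ ⟨j, b⟩ h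
  simp only [Sigma.mk.injEq, Subtype.mk.injEq] at h
  obtain ⟨rfl, h⟩ := h
  simpa using h

/-- The object `Hom*(E, F) ⊗ E`, the direct sum over `i` of `dim Hom(E, F⟦i⟧)` copies of
`E⟦-i⟧`. -/
def homTensor [IsFiniteType K D] (E F : D) : D :=
  ⨁ fun j : HomIndex K E F => E⟦-j.1⟧

/-- The morphism `E⟦-i⟧ ⟶ F` corresponding to `f : E ⟶ F⟦i⟧`. -/
def unshift {E F : D} (i : ℤ) (f : E ⟶ F⟦i⟧) : E⟦-i⟧ ⟶ F :=
  f⟦-i⟧' ≫ (shiftFunctorCompIsoId D i (-i) (add_neg_cancel i)).hom.app F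

/-- The evaluation morphism `Hom*(E, F) ⊗ E ⟶ F`. On the summand `E⟦-i⟧` belonging to
a basis vector `f` of `Hom(E, F⟦i⟧)` it is the morphism `E⟦-i⟧ ⟶ F` corresponding to `f`. -/
def ev [IsFiniteType K D] (E F : D) : homTensor K E F ⟶ F :=
  biproduct.desc fun j : HomIndex K E F =>
    haveI := IsFiniteType.finite_hom (K := K) E F j.1
    unshift j.1 (Module.finBasis K (E ⟶ F⟦j.1⟧) j.2)

/-- The functor `T` acts on objects as the spherical twist along `E`: for every `F`, the object
`T F` is a cone of the evaluation morphism `Hom*(E, F) ⊗ E ⟶ F`. -/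
def IsSphericalTwist [IsFiniteType K D] (E : D) (T : D ⥤ D) : Prop :=
  ∀ F : D, ∃ (p : F ⟶ T.obj F) (q : T.obj F ⟶ (homTensor K E F)⟦(1 : ℤ)⟧),
    Triangle.mk (ev K E F) p q ∈ distTriang D

/-- `E^⊥ ≠ 0`: there is a nonzero object `F` with `Hom*(E, F) = 0`. -/
def HasNonzeroRightOrthogonal (E : D) : Prop :=
  ∃ F : D, ¬ IsZero F ∧ ∀ (i : ℤ) (f : E ⟶ F⟦i⟧), f = 0

end Spherical

end SphericalEntropy

end

/-! Complexity behaves like a norm on objects: it is subadditive on triangles, `δ(G, X) ≤ δ(G, E)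
δ(E, X)`, exact functors do not increase it, and a shift by `m` scales it by `exp (m t)`.

Lower bound: if `T X ≅ X⟦m⟧` with `X ≠ 0`, then `δ(G, X) exp (n m t) ≤ δ(G, Tⁿ X) ≤ δ(G, Tⁿ G) δ(G,
X)`. The factor `δ(G, X)` is finite, and a count of Hom dimensions shows it is nonzero, so it
cancels (`exp_le_complexity_iterate`). This applies to `E` with `m = 1 - d`, and to objects of `E^⊥`
with `m = 0`. The bound also keeps the growth rate above `-∞`, so Fekete's lemma gives a real limit;
two generators give sequences comparable up to constants.

Upper bound: `Tⁿ` of the triangle `G → T G → (Hom*(E, G) ⊗ E)⟦1⟧` bounds the increase of `δ(G, Tⁿ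
G)` at each step by a constant times `exp (n (1 - d) t)`. Hence the growth is at most `n exp (n s)`
for any `s ≥ max 0 ((1 - d) t)` (`complexity_iterate_le_of_triangle`). -/

namespace SphericalEntropy

universe w v u

set_option linter.unusedSectionVars false

open scoped ZeroObject

/-! ### Objects built from shifts of a fixed object -/

section Built

variable {D : Type u} [Category.{v} D] [HasZeroObject D] [HasShift D ℤ] [Preadditive D]
  [∀ n : ℤ, (shiftFunctor D n).Additive] [Pretriangulated D]

lemma mk_distinguished_of_iso {X Y Z X' Y' Z' : D} {f : X ⟶ Y} {g : Y ⟶ Z} {h : Z ⟶ X⟦(1 : ℤ)⟧}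
    (hT : Triangle.mk f g h ∈ distTriang D) (a : X ≅ X') (b : Y ≅ Y') (c : Z ≅ Z')
    {f' : X' ⟶ Y'} {g' : Y' ⟶ Z'} {h' : Z' ⟶ X'⟦(1 : ℤ)⟧} (comm₁ : f ≫ b.hom = a.hom ≫ f')
    (comm₂ : g ≫ c.hom = b.hom ≫ g') (comm₃ : h ≫ a.hom⟦(1 : ℤ)⟧' = c.hom ≫ h') :
    Triangle.mk f' g' h' ∈ distTriang D :=
  isomorphic_distinguished _ hT _ (Triangle.isoMk _ _ a b c comm₁ comm₂ comm₃).symm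

lemma ConeDecomposition.of_iso {E X Y : D} {l : List ℤ} (h : ConeDecomposition E l X)
    (e : X ≅ Y) : ConeDecomposition E l Y := by
  cases h with
  | zero _ hF => exact .zero _ (hF.of_iso e.symm)
  | step l n A _ hA f g h hT =>
    refine .step l n A Y hA (f ≫ e.hom) (e.inv ≫ g) h
      (mk_distinguished_of_iso hT (Iso.refl _) e (Iso.refl _) ?_ ?_ ?_)
    · simp
    · simp
    · simp

/-- A cone decomposition can be extended along a distinguished triangle whose third object is
merely isomorphic to a shift of `E`. -/
lemma ConeDecomposition.step_of_iso {E : D} {l : List ℤ} (T : Triangle D) (hT : T ∈ distTriang D)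
    (h : ConeDecomposition E l T.obj₁) (n : ℤ) (e : T.obj₃ ≅ E⟦n⟧) :
    ConeDecomposition E (l ++ [n]) T.obj₂ := by
  refine .step l n T.obj₁ T.obj₂ h T.mor₁ (T.mor₂ ≫ e.hom) (e.inv ≫ T.mor₃)
    (mk_distinguished_of_iso (f := T.mor₁) (g := T.mor₂) (h := T.mor₃) hT
      (Iso.refl _) (Iso.refl _) e ?_ ?_ ?_)
  · simp
  · simp
  · simp

lemma ConeDecomposition.shift {E X : D} {l : List ℤ} (h : ConeDecomposition E l X) (m : ℤ) :
    ConeDecomposition E (l.map (· + m)) (X⟦m⟧) := by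
  induction h with
  | zero F hF => exact .zero _ ((shiftFunctor D m).map_isZero hF)
  | step l n A F hA f g h hT ih =>
    rw [List.map_append]
    exact ConeDecomposition.step_of_iso _ (Triangle.shift_distinguished _ hT m) ih (n + m)
      ((shiftFunctorAdd D n m).symm.app E)

lemma ConeDecomposition.map {E X : D} {l : List ℤ} (h : ConeDecomposition E l X)
    (T : D ⥤ D) [T.CommShift ℤ] [T.IsTriangulated] :
    ConeDecomposition (T.obj E) l (T.obj X) := by
  induction h with
  | zero F hF => exact .zero _ (T.map_isZero hF)
  | step l n A F hA f g h hT ih =>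
    exact ConeDecomposition.step_of_iso _ (T.map_distinguished _ hT) ih n
      ((T.commShiftIso n).app E)

/-- Peel the last component `E⟦n⟧` off `C`: by the octahedral axiom, the cocone of `B → C → E⟦n⟧` is
an extension of the shorter `C'` by `A`. -/
lemma ConeDecomposition.append [IsTriangulated D] {E A C : D} {l m : List ℤ}
    (hA : ConeDecomposition E l A) (hC : ConeDecomposition E m C) :
    ∀ {B : D} (f : A ⟶ B) (g : B ⟶ C) (h : C ⟶ A⟦(1 : ℤ)⟧),
      Triangle.mk f g h ∈ distTriang D → ConeDecomposition E (l ++ m) B := by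
  induction hC with
  | zero F hF =>
    intro B f g h hT
    have : IsIso f := (Triangle.isZero₃_iff_isIso₁ _ hT).1 hF
    simpa using hA.of_iso (asIso f)
  | step m n C' C hC' f' g' h' hT' ih =>
    intro B f g h hT
    obtain ⟨B', f'', h'', hT''⟩ := distinguished_cocone_triangle₁ (g ≫ g')
    let o := Triangulated.someOctahedron' rfl hT hT' hT''
    rw [← List.append_assoc]
    exact .step _ _ _ _ (ih _ _ _ o.mem) _ _ _ hT''

/-- `Built E l F`: the object `F` is a direct summand of an object with a cone decomposition
with components `E⟦n⟧`, `n ∈ l`. -/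
def Built (E : D) (l : List ℤ) : ObjectProperty D :=
  ObjectProperty.retractClosure (ConeDecomposition E l)

lemma ConeDecomposition.built {E X : D} {l : List ℤ} (h : ConeDecomposition E l X) :
    Built E l X := ⟨X, h, ⟨Retract.refl X⟩⟩

lemma Built.of_retract {E X Y : D} {l : List ℤ} (h : Built E l Y) (r : Retract X Y) :
    Built E l X := by
  obtain ⟨Z, hZ, ⟨s⟩⟩ := h
  exact ⟨Z, hZ, ⟨r.trans s⟩⟩

lemma built_of_isZero {E X : D} (h : IsZero X) : Built E [] X :=
  (ConeDecomposition.zero X h).built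

lemma built_self (E : D) : Built E [0] E := by
  -- Rotated backwards, `E → E → 0` becomes `0⟦-1⟧ → E → E`.
  have h := ConeDecomposition.step_of_iso (E := E) _
    (inv_rot_of_distTriang _ (contractible_distinguished E)) (l := [])
    (.zero _ ((shiftFunctor D (-1 : ℤ)).map_isZero (isZero_zero D))) 0
    ((shiftFunctorZero D ℤ).symm.app E)
  exact h.built

lemma Built.shift {E X : D} {l : List ℤ} (h : Built E l X) (m : ℤ) :
    Built E (l.map (· + m)) (X⟦m⟧) := by
  obtain ⟨Z, hZ, ⟨s⟩⟩ := h
  exact ⟨_, hZ.shift m, ⟨s.map _⟩⟩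

lemma Built.map {E X : D} {l : List ℤ} (h : Built E l X)
    (T : D ⥤ D) [T.CommShift ℤ] [T.IsTriangulated] : Built (T.obj E) l (T.obj X) := by
  obtain ⟨Z, hZ, ⟨s⟩⟩ := h
  exact ⟨_, hZ.map T, ⟨s.map _⟩⟩

/-- An extension of direct summands is a direct summand of an extension, which reduces this to
`ConeDecomposition.append`. -/
lemma Built.append [IsTriangulated D] {E : D} {l m : List ℤ} (T : Triangle D)
    (hT : T ∈ distTriang D) (h₁ : Built E l T.obj₁) (h₃ : Built E m T.obj₃) :
    Built E (l ++ m) T.obj₂ := by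
  refine ObjectProperty.monotone_retractClosure ?_ _
    (ObjectProperty.extensionProduct_retractClosure_retractClosure_le _ _ _
      ⟨_, _, T.mor₁, T.mor₂, T.mor₃, hT, h₁, h₃⟩)
  rintro X ⟨_, _, f, g, h, hT, h₁, h₃⟩
  exact h₁.append h₃ f g h hT

/-- Transitivity: if `F` is built from shifts of `E` and `X` is built from shifts of `F`, then `X`
is built from shifts of `E`. -/
lemma Built.trans [IsTriangulated D] {E F X : D} {l m : List ℤ} (hF : Built E l F)
    (hX : Built F m X) : Built E (m.flatMap fun n => l.map (· + n)) X := by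
  obtain ⟨Y, hY, ⟨r⟩⟩ := hX
  refine Built.of_retract ?_ r
  clear r X
  induction hY with
  | zero Z hZ => exact built_of_isZero hZ
  | step m n A Z hA f g h hT ih =>
    rw [List.flatMap_append]
    exact Built.append _ hT ih (by simpa using hF.shift n)

/-- The inclusion is a split mono, so the connecting morphism of its cone vanishes and the triangle
splits. -/
lemma exists_biprod_iso_of_retract {X Y : D} (r : Retract X Y) :
    ∃ X' : D, Nonempty (Y ≅ X ⊞ X') := by
  obtain ⟨X', g, h, hT⟩ := distinguished_cocone_triangle r.i
  have : Mono r.i := inferInstance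
  obtain ⟨e, -⟩ := exists_iso_binaryBiproduct_of_distTriang _ hT
    (Triangle.mor₃_eq_zero_of_mono₁ _ hT this)
  exact ⟨X', ⟨e⟩⟩

lemma built_iff {E X : D} {l : List ℤ} :
    Built E l X ↔ ∃ X' : D, ConeDecomposition E l (X ⊞ X') := by
  constructor
  · rintro ⟨Y, hY, ⟨r⟩⟩
    obtain ⟨X', ⟨e⟩⟩ := exists_biprod_iso_of_retract r
    exact ⟨X', hY.of_iso e⟩
  · rintro ⟨X', h⟩
    exact h.built.of_retract ⟨biprod.inl, biprod.fst, by simp⟩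

/-- The objects that are built from finitely many shifts of `E`. -/
def thick (E : D) : ObjectProperty D := fun X => ∃ l, Built E l X

instance (E : D) : (thick E).IsStableUnderRetracts where
  of_retract r h := h.imp fun _ h => h.of_retract r

instance (E : D) [IsTriangulated D] : (thick E).IsTriangulated where
  exists_zero := ⟨0, isZero_zero D, [], built_of_isZero (isZero_zero D)⟩
  isStableUnderShiftBy m := ⟨fun _ ⟨_, h⟩ => ⟨_, h.shift m⟩⟩
  ext₂' := fun T hT ⟨_, h₁⟩ ⟨_, h₃⟩ =>
    ObjectProperty.le_isoClosure _ _ ⟨_, Built.append T hT h₁ h₃⟩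

/-- The defining property of a split-generator, tested on `thick G`; it makes all complexities over
`G` finite. -/
lemma IsSplitGenerator.exists_built [IsTriangulated D] {G : D} (hG : IsSplitGenerator G) (X : D) :
    ∃ l, Built G l X :=
  hG (thick G) inferInstance inferInstance ⟨_, built_self G⟩ X

lemma thick_biproduct [IsTriangulated D] {E : D} {J : Type} [Finite J] {X : J → D}
    (h : ∀ j, thick E (X j)) : thick E (⨁ X) :=
  (thick E).prop_of_iso (biproduct.isoProduct X).symm ((thick E).prop_product h)

lemma thick_shift [IsTriangulated D] {E X : D} (hX : thick E X) (n : ℤ) : thick E (X⟦n⟧) := by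
  obtain ⟨l, h⟩ := hX
  exact ⟨_, h.shift n⟩

end Built

/-! ### Weights of lists of shifts -/

/-- The weight `∑ exp (n t)` of a list of shifts. -/
noncomputable def weight (l : List ℤ) (t : ℝ) : ℝ≥0∞ :=
  (l.map fun n : ℤ => ENNReal.ofReal (Real.exp ((n : ℝ) * t))).sum

@[simp] lemma weight_nil (t : ℝ) : weight [] t = 0 := rfl

lemma weight_append (l m : List ℤ) (t : ℝ) : weight (l ++ m) t = weight l t + weight m t := by
  simp [weight]

@[simp] lemma weight_cons (n : ℤ) (l : List ℤ) (t : ℝ) :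
    weight (n :: l) t = ENNReal.ofReal (Real.exp ((n : ℝ) * t)) + weight l t := by
  simp [weight]

lemma weight_ne_top (l : List ℤ) (t : ℝ) : weight l t ≠ ∞ := by
  induction l with
  | nil => simp
  | cons n l ih =>
    rw [weight_cons]
    exact ENNReal.add_ne_top.2 ⟨ENNReal.ofReal_ne_top, ih⟩

lemma weight_shift (l : List ℤ) (m : ℤ) (t : ℝ) :
    weight (l.map (· + m)) t = weight l t * ENNReal.ofReal (Real.exp ((m : ℝ) * t)) := by
  induction l with
  | nil => simp
  | cons n l ih =>
    rw [List.map_cons, weight_cons, ih, weight_cons, add_mul,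
      ← ENNReal.ofReal_mul (Real.exp_pos _).le, ← Real.exp_add, Int.cast_add, add_mul]

lemma weight_flatMap (l m : List ℤ) (t : ℝ) :
    weight (m.flatMap fun n => l.map (· + n)) t = weight l t * weight m t := by
  induction m with
  | nil => simp
  | cons n m ih =>
    rw [List.flatMap_cons, weight_append, ih, weight_shift, weight_cons, mul_add]

/-! ### Formal properties of the complexity -/

section Complexity

variable {D : Type u} [Category.{v} D] [HasZeroObject D] [HasShift D ℤ] [Preadditive D]
  [∀ n : ℤ, (shiftFunctor D n).Additive] [Pretriangulated D]

/-- The separate value at zero objects is automatic here, since the empty list builds them with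
weight `0`. -/
lemma complexity_eq (E F : D) (t : ℝ) :
    complexity E F t = ⨅ (l : List ℤ) (_ : Built E l F), weight l t := by
  have h : (⨅ (l : List ℤ) (F' : D) (_ : ConeDecomposition E l (F ⊞ F')), weight l t) =
      ⨅ (l : List ℤ) (_ : Built E l F), weight l t := by
    refine iInf_congr fun l => ?_
    simp_rw [built_iff, iInf_exists]
  rw [complexity]
  split_ifs with hF
  · refine le_antisymm zero_le (iInf₂_le_of_le [] (built_of_isZero hF) ?_)
    simp
  · exact h

lemma Built.complexity_le {E F : D} {l : List ℤ} (h : Built E l F) (t : ℝ) :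
    complexity E F t ≤ weight l t := by
  rw [complexity_eq]
  exact iInf₂_le l h

lemma complexity_ne_top {E F : D} (h : thick E F) (t : ℝ) : complexity E F t ≠ ∞ := by
  obtain ⟨l, hl⟩ := h
  exact ne_top_of_le_ne_top (weight_ne_top l t) (hl.complexity_le t)

lemma complexity_mono {E F E' F' : D} (t : ℝ) (h : ∀ l, Built E l F → Built E' l F') :
    complexity E' F' t ≤ complexity E F t := by
  simp only [complexity_eq]
  exact le_iInf₂ fun l hl => iInf₂_le l (h l hl)

lemma complexity_le_of_retract (E : D) {F F' : D} (r : Retract F F') (t : ℝ) :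
    complexity E F t ≤ complexity E F' t :=
  complexity_mono t fun _ h => h.of_retract r

lemma complexity_map_le (E F : D) (T : D ⥤ D) [T.CommShift ℤ] [T.IsTriangulated] (t : ℝ) :
    complexity (T.obj E) (T.obj F) t ≤ complexity E F t :=
  complexity_mono t fun _ h => h.map T

lemma complexity_iterate_le (E F : D) (T : D ⥤ D) [T.CommShift ℤ] [T.IsTriangulated] (t : ℝ)
    (n : ℕ) : complexity (T.obj^[n] E) (T.obj^[n] F) t ≤ complexity E F t := by
  induction n with
  | zero => exact le_rfl
  | succ n ih =>
    simp only [Function.iterate_succ_apply']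
    exact (complexity_map_le _ _ T t).trans ih

lemma complexity_self_le (E : D) (t : ℝ) : complexity E E t ≤ 1 := by
  simpa using (built_self E).complexity_le t

lemma complexity_shift_le {E F : D} (h : thick E F) (m : ℤ) (t : ℝ) :
    complexity E (F⟦m⟧) t ≤ complexity E F t * ENNReal.ofReal (Real.exp ((m : ℝ) * t)) := by
  have : Nonempty {l // Built E l F} := let ⟨l, hl⟩ := h; ⟨⟨l, hl⟩⟩
  rw [complexity_eq E F, iInf_subtype', ENNReal.iInf_mul (by simp)]
  refine le_iInf fun ⟨l, hl⟩ => ?_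
  rw [← weight_shift]
  exact (hl.shift m).complexity_le t

lemma complexity_le_add [IsTriangulated D] (E : D) (T : Triangle D) (hT : T ∈ distTriang D)
    (t : ℝ) : complexity E T.obj₂ t ≤ complexity E T.obj₁ t + complexity E T.obj₃ t := by
  rw [complexity_eq E T.obj₁, complexity_eq E T.obj₃, iInf_subtype', iInf_subtype']
  refine ENNReal.le_iInf_add_iInf fun ⟨l, hl⟩ ⟨m, hm⟩ => ?_
  rw [← weight_append]
  exact (Built.append T hT hl hm).complexity_le t

lemma complexity_le_mul [IsTriangulated D] {E F X : D} (hF : thick E F) (hX : thick F X) (t : ℝ) :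
    complexity E X t ≤ complexity E F t * complexity F X t := by
  have : Nonempty {l // Built E l F} := let ⟨l, hl⟩ := hF; ⟨⟨l, hl⟩⟩
  have : Nonempty {l // Built F l X} := let ⟨l, hl⟩ := hX; ⟨⟨l, hl⟩⟩
  rw [complexity_eq E F, complexity_eq F X, iInf_subtype', iInf_subtype']
  -- A finite weight on each side excludes the product `0 * ∞`.
  refine ENNReal.le_iInf_mul_iInf ⟨Classical.arbitrary _, weight_ne_top _ _⟩
    ⟨Classical.arbitrary _, weight_ne_top _ _⟩ fun ⟨l, hl⟩ ⟨m, hm⟩ => ?_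
  rw [← weight_flatMap]
  exact (hl.trans hm).complexity_le t

end Complexity

/-! ### Positivity of the complexity via Hom dimensions -/

section GradedDimension

variable (K : Type w) [Field K] {D : Type u} [Category.{v} D] [HasZeroObject D] [HasShift D ℤ]
  [Preadditive D] [∀ n : ℤ, (shiftFunctor D n).Additive] [Pretriangulated D] [Linear K D]

/-- The weighted total dimension `∑ i, dim Hom(X, A⟦i⟧) exp (-i t)`. -/
noncomputable def gradedDim (X : D) (t : ℝ) (A : D) : ℝ≥0∞ :=
  ∑' i : ℤ, (Module.finrank K (X ⟶ A⟦i⟧) : ℝ≥0∞) * ENNReal.ofReal (Real.exp (-(i : ℝ) * t))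

variable [IsFiniteType K D]

lemma gradedDim_ne_top (X : D) (t : ℝ) (A : D) : gradedDim K X t A ≠ ∞ := by
  have hf := IsFiniteType.finite_support (K := K) X A
  rw [gradedDim, tsum_eq_sum (s := hf.toFinset)]
  · exact ENNReal.sum_ne_top.2 fun i _ =>
      ENNReal.mul_ne_top (ENNReal.natCast_ne_top _) ENNReal.ofReal_ne_top
  · intro i hi
    have : Module.finrank K (X ⟶ A⟦i⟧) = 0 := by simpa using hi
    simp [this]

lemma gradedDim_self_ne_zero (t : ℝ) {X : D} (hX : ¬ IsZero X) : gradedDim K X t X ≠ 0 := by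
  have := IsFiniteType.finite_hom (K := K) X X 0
  intro h
  have h0 := ENNReal.tsum_eq_zero.1 h 0
  have hd : Module.finrank K (X ⟶ X⟦(0 : ℤ)⟧) = 0 := by simpa using h0
  have hs := Module.finrank_zero_iff.1 hd
  refine hX ((IsZero.iff_id_eq_zero X).2 ?_)
  rw [← cancel_mono ((shiftFunctorZero D ℤ).inv.app X)]
  exact Subsingleton.elim _ _

lemma gradedDim_of_isZero (X : D) (t : ℝ) {A : D} (hA : IsZero A) : gradedDim K X t A = 0 := by
  refine ENNReal.tsum_eq_zero.2 fun i => ?_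
  have : Subsingleton (X ⟶ A⟦i⟧) :=
    ⟨fun f g => ((shiftFunctor D i).map_isZero hA).eq_of_tgt f g⟩
  simp [Module.finrank_zero_of_subsingleton]

lemma gradedDim_le_of_retract (X : D) (t : ℝ) {A B : D} (r : Retract A B) :
    gradedDim K X t A ≤ gradedDim K X t B := by
  refine ENNReal.tsum_le_tsum fun i => ?_
  have := IsFiniteType.finite_hom (K := K) X B i
  gcongr
  refine LinearMap.finrank_le_finrank_of_injective (f := Linear.rightComp K X (r.i⟦i⟧')) ?_
  intro f g h
  simpa [← Functor.map_comp] using congr($h ≫ r.r⟦i⟧')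

lemma gradedDim_le_add (X : D) (t : ℝ) (T : Triangle D) (hT : T ∈ distTriang D) :
    gradedDim K X t T.obj₂ ≤ gradedDim K X t T.obj₁ + gradedDim K X t T.obj₃ := by
  rw [gradedDim, gradedDim, gradedDim, ← ENNReal.tsum_add]
  refine ENNReal.tsum_le_tsum fun i => ?_
  rw [← add_mul, ← Nat.cast_add]
  have := IsFiniteType.finite_hom (K := K) X T.obj₁ i
  have := IsFiniteType.finite_hom (K := K) X T.obj₂ i
  have := IsFiniteType.finite_hom (K := K) X T.obj₃ i
  gcongr
  let p := Linear.rightComp K X (T.mor₁⟦i⟧')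
  let q := Linear.rightComp K X (T.mor₂⟦i⟧')
  -- Exactness of `Hom(X, -)` at the middle term. The shifted triangle carries signs `(-1)^i`,
  -- absorbed into the lift `g`.
  have hpq : LinearMap.ker q ≤ LinearMap.range p := by
    intro f hf
    have hf' : f ≫ T.mor₂⟦i⟧' = 0 := hf
    obtain ⟨(g : X ⟶ T.obj₁⟦i⟧), hg⟩ := Triangle.coyoneda_exact₂ _ (Triangle.shift_distinguished T hT i) f (by
      change f ≫ (i.negOnePow • T.mor₂⟦i⟧') = 0
      rw [Linear.comp_units_smul, hf', smul_zero])
    replace hg : f = g ≫ (i.negOnePow • T.mor₁⟦i⟧') := hg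
    refine ⟨i.negOnePow • g, ?_⟩
    change (i.negOnePow • g) ≫ T.mor₁⟦i⟧' = f
    rw [Linear.units_smul_comp, ← Linear.comp_units_smul]
    exact hg.symm
  have h₁ := q.finrank_range_add_finrank_ker
  have h₂ := p.finrank_range_le
  have h₃ := (LinearMap.range q).finrank_le
  have h₄ := Submodule.finrank_mono hpq
  omega

lemma gradedDim_shift (X : D) (t : ℝ) (A : D) (n : ℤ) :
    gradedDim K X t (A⟦n⟧) = ENNReal.ofReal (Real.exp ((n : ℝ) * t)) * gradedDim K X t A := by
  rw [gradedDim, gradedDim, ← (Equiv.addLeft n).tsum_eq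
    (fun i : ℤ => (Module.finrank K (X ⟶ A⟦i⟧) : ℝ≥0∞) * ENNReal.ofReal (Real.exp (-(i : ℝ) * t))),
    ← ENNReal.tsum_mul_left]
  refine tsum_congr fun i => ?_
  have h : Module.finrank K (X ⟶ A⟦n⟧⟦i⟧) = Module.finrank K (X ⟶ A⟦n + i⟧) :=
    (Linear.homCongr K (Iso.refl X) ((shiftFunctorAdd D n i).symm.app A)).finrank_eq
  rw [h, Equiv.coe_addLeft, mul_left_comm, ← ENNReal.ofReal_mul (Real.exp_pos _).le,
    ← Real.exp_add]
  push_cast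
  ring_nf

lemma Built.gradedDim_le {E F : D} {l : List ℤ} (h : Built E l F) (X : D) (t : ℝ) :
    gradedDim K X t F ≤ weight l t * gradedDim K X t E := by
  obtain ⟨Y, hY, ⟨r⟩⟩ := h
  refine (gradedDim_le_of_retract K X t r).trans ?_
  clear r F
  induction hY with
  | zero Z hZ => simp [gradedDim_of_isZero K X t hZ]
  | step l n A Z hA f g h hT ih =>
    refine (gradedDim_le_add K X t _ hT).trans ?_
    rw [weight_append, add_mul, weight_cons, weight_nil, add_zero, ← gradedDim_shift]
    exact add_le_add ih le_rfl

include K in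
-- Probe with `Hom(F, -)`: every list building `F` weighs at least `gradedDim F F / gradedDim F E`,
-- whose numerator sees the identity of `F` and whose denominator is finite.
lemma complexity_ne_zero (E : D) {F : D} (hF : ¬ IsZero F) (t : ℝ) : complexity E F t ≠ 0 := by
  have h : gradedDim K F t F / gradedDim K F t E ≤ complexity E F t := by
    rw [complexity_eq]
    exact le_iInf₂ fun l hl => ENNReal.div_le_of_le_mul (hl.gradedDim_le K F t)
  intro h0
  rw [h0, nonpos_iff_eq_zero, ENNReal.div_eq_zero_iff] at h
  exact h.elim (gradedDim_self_ne_zero K t hF) (gradedDim_ne_top K F t E)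

end GradedDimension

/-! ### Action of the twist on `E` and on `E^⊥` -/

section Twist

variable (K : Type w) [Field K] {D : Type u} [Category.{v} D] [HasZeroObject D] [HasShift D ℤ]
  [Preadditive D] [∀ n : ℤ, (shiftFunctor D n).Additive] [Pretriangulated D] [Linear K D]

/-- A morphism to `A` from a biproduct of two objects that restricts to an isomorphism on the second
summand `A'` has the shift of the first summand as a cone. -/
lemma nonempty_iso_shift_of_isIso {B A' A Y Z : D} (e : Y ≅ B ⊞ A') (f : Y ⟶ A)
    (hf : IsIso (biprod.inr ≫ e.inv ≫ f)) {p : A ⟶ Z} {q : Z ⟶ Y⟦(1 : ℤ)⟧}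
    (hT : Triangle.mk f p q ∈ distTriang D) : Nonempty (Z ≅ B⟦(1 : ℤ)⟧) := by
  obtain ⟨u, hu⟩ : ∃ u : A' ⟶ A, u = biprod.inr ≫ e.inv ≫ f := ⟨_, rfl⟩
  obtain ⟨b, hb⟩ : ∃ b : B ⟶ A, b = biprod.inl ≫ e.inv ≫ f := ⟨_, rfl⟩
  rw [← hu] at hf
  -- A shear removing the component `b`; after it, `f` is the projection to `A'` followed by `u`.
  let s : B ⊞ A' ≅ B ⊞ A' :=
    { hom := 𝟙 _ - biprod.fst ≫ b ≫ inv u ≫ biprod.inr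
      inv := 𝟙 _ + biprod.fst ≫ b ≫ inv u ≫ biprod.inr
      hom_inv_id := by ext <;> simp
      inv_hom_id := by ext <;> simp }
  have h₁ := rot_of_distTriang _ (binaryBiproductTriangle_distinguished B A')
  let a : A ≅ A' := (asIso u).symm
  have comm : f ≫ a.hom = (e ≪≫ s.symm).hom ≫ biprod.snd := by
    rw [← cancel_epi e.inv]
    ext <;> simp [s, a, reassoc_of% hu.symm, reassoc_of% hb.symm]
  exact ⟨Triangle.π₃.mapIso (isoTriangleOfIso₁₂ _ _ hT h₁ (e ≪≫ s.symm) a comm)⟩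

/-- A biproduct over a two element type as a binary biproduct. -/
noncomputable def biproductIsoBiprod {J : Type} [Finite J] (X : J → D) (i j : J) (hij : i ≠ j)
    (h : ∀ k, k = i ∨ k = j) : (⨁ X) ≅ X i ⊞ X j where
  hom := biprod.lift (biproduct.π X i) (biproduct.π X j)
  inv := biprod.desc (biproduct.ι X i) (biproduct.ι X j)
  hom_inv_id := by
    ext k l
    obtain rfl | rfl := h k <;> obtain rfl | rfl := h l <;>
      simp [biprod.lift_desc, hij, hij.symm]
  inv_hom_id := by
    ext <;> simp [hij, hij.symm]

namespace IsSpherical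

variable {K} {E : D} {d : ℤ}

lemma finrank_eq_one (hE : IsSpherical K E d) {i : ℤ} (x : DualNumber K) (hx : x ≠ 0)
    (hxi : x ∈ dualNumberDegree K d i) (h : ∀ y ∈ dualNumberDegree K d i, ∃ c : K, c • x = y) :
    Module.finrank K (E ⟶ E⟦i⟧) = 1 := by
  obtain ⟨φ, inj, rng, -⟩ := hE.algebra_iso
  rw [← rng i] at hxi h
  obtain ⟨v, rfl⟩ := hxi
  refine _root_.finrank_eq_one v ?_ fun w => ?_
  · rintro rfl
    exact hx (map_zero _)
  · obtain ⟨c, hc⟩ := h _ ⟨w, rfl⟩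
    exact ⟨c, inj i (by rw [map_smul, hc])⟩

lemma finrank_zero (hE : IsSpherical K E d) : Module.finrank K (E ⟶ E⟦(0 : ℤ)⟧) = 1 := by
  have := hE.pos
  refine hE.finrank_eq_one 1 one_ne_zero ⟨by simp, by simp⟩ ?_
  rintro y ⟨-, hy⟩
  exact ⟨y.fst, by ext <;> simp [hy (by omega)]⟩

lemma finrank_degree (hE : IsSpherical K E d) : Module.finrank K (E ⟶ E⟦d⟧) = 1 := by
  have := hE.pos
  refine hE.finrank_eq_one DualNumber.eps ?_ ⟨by simp, by simp⟩ ?_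
  · intro h
    simpa using congr(TrivSqZeroExt.snd $h)
  · rintro y ⟨hy, -⟩
    exact ⟨y.snd, by ext <;> simp [hy (by omega)]⟩

lemma finrank_of_ne (hE : IsSpherical K E d) {i : ℤ} (h₀ : i ≠ 0) (hd : i ≠ d) :
    Module.finrank K (E ⟶ E⟦i⟧) = 0 := by
  obtain ⟨φ, inj, rng, -⟩ := hE.algebra_iso
  have : Subsingleton (E ⟶ E⟦i⟧) := by
    have key : ∀ f : E ⟶ E⟦i⟧, φ i f = 0 := fun f => by
      have h : φ i f ∈ dualNumberDegree K d i := rng i ▸ ⟨f, rfl⟩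
      ext
      · simpa using h.1 h₀
      · simpa using h.2 hd
    exact ⟨fun f g => inj i ((key f).trans (key g).symm)⟩
  exact Module.finrank_zero_of_subsingleton

/-- As `d ≠ 0`, the degree `0` part of `K[h]/(h²)` is the scalars, so `f` is a multiple of the
canonical isomorphism. -/
lemma isIso_of_ne_zero (hE : IsSpherical K E d) (f : E ⟶ E⟦(0 : ℤ)⟧) (hf : f ≠ 0) : IsIso f := by
  have hd := hE.pos
  obtain ⟨φ, inj, rng, h1, -⟩ := hE.algebra_iso
  have h : φ 0 f ∈ dualNumberDegree K d 0 := rng 0 ▸ ⟨f, rfl⟩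
  let g : E ≅ E⟦(0 : ℤ)⟧ := (shiftFunctorZero D ℤ).symm.app E
  have hg : φ 0 g.hom = 1 := by
    rw [← h1]
    congr 1
    simp [ShiftedHom.mk₀, g, shiftFunctorZero']
  obtain ⟨c, hc⟩ : ∃ c : K, c = (φ 0 f).fst := ⟨_, rfl⟩
  have hfg : f = c • g.hom := by
    refine inj 0 ?_
    rw [map_smul, hg]
    ext
    · simp [hc]
    · simpa using h.2 (by omega)
  have hc0 : c ≠ 0 := by
    rintro rfl
    exact hf (by rw [hfg, zero_smul])
  refine ⟨c⁻¹ • g.inv, ?_, ?_⟩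
  · simp [hfg, smul_smul, inv_mul_cancel₀ hc0]
  · simp [hfg, smul_smul, mul_inv_cancel₀ hc0]

lemma not_isZero (hE : IsSpherical K E d) : ¬ IsZero E := by
  intro h
  have h1 := hE.finrank_zero
  have : Subsingleton (E ⟶ E⟦(0 : ℤ)⟧) := ⟨fun f g => h.eq_of_src f g⟩
  rw [Module.finrank_zero_of_subsingleton] at h1
  exact zero_ne_one h1

/-- The spherical twist along `E` sends `E` to `E⟦1 - d⟧`. -/
lemma nonempty_iso_shift [IsFiniteType K D] (hE : IsSpherical K E d) {T : D ⥤ D}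
    (hT : IsSphericalTwist K E T) : Nonempty (T.obj E ≅ E⟦1 - d⟧) := by
  have hd := hE.pos
  obtain ⟨p, q, hpq⟩ := hT E
  -- The only two summands of `Hom*(E, E) ⊗ E`: `E⟦-d⟧` from degree `d` and `E⟦0⟧` from degree `0`.
  -- Evaluation is invertible on the latter, so the cone is `E⟦-d⟧⟦1⟧`.
  let i : HomIndex K E E := ⟨d, ⟨0, by rw [hE.finrank_degree]; exact one_pos⟩⟩
  let j : HomIndex K E E := ⟨0, ⟨0, by rw [hE.finrank_zero]; exact one_pos⟩⟩
  have hij : i ≠ j := fun h => hd.ne' congr($h.1)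
  have hk : ∀ k : HomIndex K E E, k = i ∨ k = j := by
    rintro ⟨k, a⟩
    by_cases h₁ : k = d
    · subst h₁
      have := hE.finrank_degree
      exact Or.inl (Sigma.ext rfl (heq_of_eq (Fin.ext (by have := a.2; simp [i]; omega))))
    · by_cases h₀ : k = 0
      · subst h₀
        have := hE.finrank_zero
        exact Or.inr (Sigma.ext rfl (heq_of_eq (Fin.ext (by have := a.2; simp [j]; omega))))
      · have := hE.finrank_of_ne h₀ h₁
        exact absurd a.2 (by omega)
  let e := biproductIsoBiprod (fun k : HomIndex K E E => E⟦-k.1⟧) i j hij hk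
  have hiso : IsIso (biprod.inr ≫ e.inv ≫ ev K E E) := by
    have := IsFiniteType.finite_hom (K := K) E E 0
    have h : biprod.inr ≫ e.inv ≫ ev K E E =
        unshift 0 (Module.finBasis K (E ⟶ E⟦(0 : ℤ)⟧) j.2) := by
      simp [e, biproductIsoBiprod, ev]
      rfl
    rw [h]
    have := hE.isIso_of_ne_zero _ ((Module.finBasis K (E ⟶ E⟦(0 : ℤ)⟧)).ne_zero j.2)
    unfold unshift
    infer_instance
  obtain ⟨e'⟩ := nonempty_iso_shift_of_isIso e _ hiso hpq
  exact ⟨e' ≪≫ (shiftFunctorAdd' D (-d) 1 (1 - d) (by ring)).symm.app E⟩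

end IsSpherical

lemma nonempty_iterate_iso_shift {T : D ⥤ D} [T.CommShift ℤ] {X : D} {m : ℤ}
    (h : Nonempty (T.obj X ≅ X⟦m⟧)) (n : ℕ) : Nonempty (T.obj^[n] X ≅ X⟦n * m⟧) := by
  obtain ⟨e⟩ := h
  induction n with
  | zero => exact ⟨(shiftFunctorZero' D _ (by simp)).symm.app X⟩
  | succ n ih =>
    obtain ⟨e'⟩ := ih
    rw [Function.iterate_succ_apply']
    exact ⟨T.mapIso e' ≪≫ (T.commShiftIso (n * m)).app X ≪≫ (shiftFunctor D _).mapIso e ≪≫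
      (shiftFunctorAdd' D m (n * m) _ (by push_cast; ring)).symm.app X⟩

variable {K} in
-- The source of the evaluation is zero. The shift by `0` puts the result in the form `X⟦m⟧` needed
-- for the lower bound.
lemma IsSphericalTwist.nonempty_iso_of_orthogonal [IsFiniteType K D] {E : D} {T : D ⥤ D}
    (hT : IsSphericalTwist K E T) {F : D} (hF : ∀ (i : ℤ) (f : E ⟶ F⟦i⟧), f = 0) :
    Nonempty (T.obj F ≅ F⟦(0 : ℤ)⟧) := by
  obtain ⟨p, q, hpq⟩ := hT F
  have h0 : IsZero (homTensor K E F) := by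
    rw [IsZero.iff_id_eq_zero]
    refine biproduct.hom_ext' _ _ fun ⟨i, a⟩ => ?_
    have : Subsingleton (E ⟶ F⟦i⟧) := ⟨fun f g => (hF i f).trans (hF i g).symm⟩
    have hn : Module.finrank K (E ⟶ F⟦i⟧) = 0 := Module.finrank_zero_of_subsingleton
    exact absurd a.2 (by omega)
  have : IsIso p := (Triangle.isZero₁_iff_isIso₂ _ hpq).1 h0
  exact ⟨(asIso p).symm ≪≫ (shiftFunctorZero D ℤ).symm.app F⟩

end Twist

/-! ### Growth rates of sequences in `[0, ∞]` -/

section Growth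

lemma tendsto_ennreal_log_div {δ : ℕ → ℝ≥0∞} (h0 : ∀ n, δ n ≠ 0) (htop : ∀ n, δ n ≠ ∞) {h : ℝ}
    (H : Tendsto (fun n : ℕ => Real.log (δ n).toReal / n) atTop (𝓝 h)) :
    Tendsto (fun n : ℕ => ENNReal.log (δ n) / (n : EReal)) atTop (𝓝 (h : EReal)) := by
  refine ((continuous_coe_real_ereal.tendsto h).comp H).congr fun n => ?_
  rw [ENNReal.log_pos_real (h0 n) (htop n), Function.comp_apply, EReal.coe_div,
    EReal.coe_natCast]

lemma mul_le_log_toReal {x : ℝ≥0∞} (htop : x ≠ ∞) {c : ℝ}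
    (hc : ENNReal.ofReal (Real.exp c) ≤ x) : c ≤ Real.log x.toReal := by
  have h := (ENNReal.ofReal_le_iff_le_toReal htop).1 hc
  exact (Real.le_log_iff_exp_le ((Real.exp_pos c).trans_le h)).2 h

lemma log_toReal_le_add {x y C : ℝ≥0∞} (hx : x ≠ 0) (hy : y ≠ ∞) (hC : C ≠ ∞)
    (h : x ≤ C * y) : Real.log x.toReal ≤ Real.log C.toReal + Real.log y.toReal := by
  have hCy : C * y ≠ 0 := fun h0 => hx (le_antisymm (h0 ▸ h) zero_le)
  rw [← Real.log_mul (ENNReal.toReal_pos (left_ne_zero_of_mul hCy) hC).ne'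
    (ENNReal.toReal_pos (right_ne_zero_of_mul hCy) hy).ne', ← ENNReal.toReal_mul]
  have hCy' : C * y ≠ ∞ := ENNReal.mul_ne_top hC hy
  exact Real.log_le_log (ENNReal.toReal_pos hx (ne_top_of_le_ne_top hCy' h))
    (ENNReal.toReal_mono hCy' h)

/-- Fekete's lemma for submultiplicative sequences with an exponential lower bound. -/
lemma exists_tendsto_log_div {δ : ℕ → ℝ≥0∞} (h0 : ∀ n, δ n ≠ 0) (htop : ∀ n, δ n ≠ ∞)
    (hmul : ∀ m n, δ (m + n) ≤ δ m * δ n) (c : ℝ)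
    (hc : ∀ n : ℕ, ENNReal.ofReal (Real.exp (n * c)) ≤ δ n) :
    ∃ h : ℝ, Tendsto (fun n : ℕ => Real.log (δ n).toReal / n) atTop (𝓝 h) := by
  have hsub : Subadditive fun n => Real.log (δ n).toReal :=
    fun m n => log_toReal_le_add (h0 _) (htop n) (htop m) (hmul m n)
  -- The minimum with `0` covers `n = 0`, where the quotient is `0`.
  refine ⟨hsub.lim, hsub.tendsto_lim ⟨min c 0, ?_⟩⟩
  rintro _ ⟨n, rfl⟩
  rcases n.eq_zero_or_pos with rfl | hn
  · simp
  · refine (min_le_left _ _).trans ((le_div_iff₀ (by positivity)).2 ?_)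
    rw [mul_comm]
    exact mul_le_log_toReal (htop n) (hc n)

lemma tendsto_log_div_of_comparable {δ ε : ℕ → ℝ≥0∞} (hδ0 : ∀ n, δ n ≠ 0) (hδ : ∀ n, δ n ≠ ∞)
    (hε0 : ∀ n, ε n ≠ 0) (hε : ∀ n, ε n ≠ ∞) {C C' : ℝ≥0∞} (hC : C ≠ ∞) (hC' : C' ≠ ∞)
    (h₁ : ∀ n, ε n ≤ C * δ n) (h₂ : ∀ n, δ n ≤ C' * ε n) {h : ℝ}
    (H : Tendsto (fun n : ℕ => Real.log (δ n).toReal / n) atTop (𝓝 h)) :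
    Tendsto (fun n : ℕ => Real.log (ε n).toReal / n) atTop (𝓝 h) := by
  have hlow := H.sub (tendsto_const_div_atTop_nhds_zero_nat (Real.log C'.toReal))
  have hupp := H.add (tendsto_const_div_atTop_nhds_zero_nat (Real.log C.toReal))
  rw [sub_zero] at hlow
  rw [add_zero] at hupp
  refine tendsto_of_tendsto_of_tendsto_of_le_of_le hlow hupp (fun n => ?_) fun n => ?_
  · have := log_toReal_le_add (hδ0 n) (hε n) hC' (h₂ n)
    rw [← sub_div]
    gcongr
    linarith
  · have := log_toReal_le_add (hε0 n) (hδ n) hC (h₁ n)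
    rw [← add_div]
    gcongr
    linarith

lemma le_of_tendsto_log_div {δ : ℕ → ℝ≥0∞} (hδ : ∀ n, δ n ≠ ∞) {h c : ℝ}
    (H : Tendsto (fun n : ℕ => Real.log (δ n).toReal / n) atTop (𝓝 h))
    (hc : ∀ n : ℕ, ENNReal.ofReal (Real.exp (n * c)) ≤ δ n) : c ≤ h := by
  refine ge_of_tendsto H ((eventually_gt_atTop 0).mono fun n hn => ?_)
  rw [le_div_iff₀ (by positivity), mul_comm]
  exact mul_le_log_toReal (hδ n) (hc n)

/-- A sequence growing at most like `n exp (n s)` has exponential growth rate at most `s`. -/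
lemma tendsto_log_div_le {δ : ℕ → ℝ≥0∞} (h0 : ∀ n, δ n ≠ 0) {h s : ℝ} {C : ℝ≥0∞} (hC : C ≠ ∞)
    (H : Tendsto (fun n : ℕ => Real.log (δ n).toReal / n) atTop (𝓝 h))
    (hs : ∀ n : ℕ, δ n ≤ (1 + n * C) * ENNReal.ofReal (Real.exp (n * s))) : h ≤ s := by
  have hlog : Tendsto (fun n : ℕ => Real.log n / n) atTop (𝓝 0) :=
    Real.isLittleO_log_id_atTop.tendsto_div_nhds_zero.comp tendsto_natCast_atTop_atTop
  have hlim := ((tendsto_const_div_atTop_nhds_zero_nat (Real.log (1 + C).toReal)).add hlog).add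
    (tendsto_const_nhds (x := s))
  rw [zero_add, zero_add] at hlim
  refine le_of_tendsto_of_tendsto H hlim ((eventually_gt_atTop 0).mono fun n hn => ?_)
  have hn' : (1 : ℝ≥0∞) ≤ n := by exact_mod_cast hn
  have h1C : 1 + C ≠ ∞ := ENNReal.add_ne_top.2 ⟨ENNReal.one_ne_top, hC⟩
  -- For `n ≥ 1`, `1 + n C ≤ (1 + C) n`; the logarithm then splits into a constant, `log n` and `n
  -- s`.
  have hle : δ n ≤ (1 + C) * (n * ENNReal.ofReal (Real.exp (n * s))) := by
    refine (hs n).trans ?_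
    rw [← mul_assoc]
    gcongr
    rw [add_mul, one_mul, mul_comm C]
    gcongr
  have htop : (n : ℝ≥0∞) * ENNReal.ofReal (Real.exp (n * s)) ≠ ∞ :=
    ENNReal.mul_ne_top (ENNReal.natCast_ne_top n) ENNReal.ofReal_ne_top
  have key := log_toReal_le_add (h0 n) htop h1C hle
  have hn0 : (0 : ℝ) < n := by exact_mod_cast hn
  rw [ENNReal.toReal_mul, ENNReal.toReal_natCast, ENNReal.toReal_ofReal (Real.exp_pos _).le,
    Real.log_mul hn0.ne' (Real.exp_pos _).ne', Real.log_exp] at key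
  beta_reduce
  rw [← add_div, div_add' _ _ _ hn0.ne']
  gcongr
  linarith

end Growth

/-! ### Growth of the complexity under iteration -/

section Entropy

variable {D : Type u} [Category.{v} D] [HasZeroObject D] [HasShift D ℤ] [Preadditive D]
  [∀ n : ℤ, (shiftFunctor D n).Additive] [Pretriangulated D] [IsTriangulated D]
  {T : D ⥤ D} [T.CommShift ℤ] [T.IsTriangulated]

lemma complexity_le_of_shift {G X : D} {m : ℤ} (h : thick G X) (t : ℝ) :
    complexity G X t ≤ complexity G (X⟦m⟧) t * ENNReal.ofReal (Real.exp (-(m * t))) := by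
  have e : X ≅ X⟦m⟧⟦-m⟧ := (shiftFunctorCompIsoId D m (-m) (add_neg_cancel m)).symm.app X
  refine (complexity_le_of_retract G (Retract.ofIso e) t).trans ?_
  simpa using complexity_shift_le (thick_shift h m) (-m) t

variable (T) in
lemma thick_iterate {E X : D} (h : thick E X) (n : ℕ) : thick (T.obj^[n] E) (T.obj^[n] X) := by
  induction n with
  | zero => exact h
  | succ n ih =>
    obtain ⟨l, hl⟩ := ih
    simp only [Function.iterate_succ_apply']
    exact ⟨l, hl.map T⟩

/-- `T.obj^[n]` iterates on objects only, so the triangle is specified through its vertices. -/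
lemma exists_distinguished_iterate (S : Triangle D) (hS : S ∈ distTriang D) (n : ℕ) :
    ∃ S' ∈ distTriang D, S'.obj₁ = T.obj^[n] S.obj₁ ∧ S'.obj₂ = T.obj^[n] S.obj₂ ∧
      S'.obj₃ = T.obj^[n] S.obj₃ := by
  induction n with
  | zero => exact ⟨S, hS, rfl, rfl, rfl⟩
  | succ n ih =>
    obtain ⟨S', hS', h₁, h₂, h₃⟩ := ih
    simp only [Function.iterate_succ_apply', ← h₁, ← h₂, ← h₃]
    exact ⟨_, T.map_distinguished _ hS', rfl, rfl, rfl⟩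

lemma complexity_iterate_le_add (G : D) (S : Triangle D) (hS : S ∈ distTriang D) (n : ℕ) (t : ℝ) :
    complexity G (T.obj^[n] S.obj₂) t ≤
      complexity G (T.obj^[n] S.obj₁) t + complexity G (T.obj^[n] S.obj₃) t := by
  obtain ⟨S', hS', h₁, h₂, h₃⟩ := exists_distinguished_iterate (T := T) S hS n
  rw [← h₁, ← h₂, ← h₃]
  exact complexity_le_add G S' hS' t

namespace IsSplitGenerator

variable {G : D} (hG : IsSplitGenerator G)
include hG

lemma thick (X : D) : SphericalEntropy.thick G X := hG.exists_built X

/-- Pass through `Tᵐ G`: building `Tᵐ (Tⁿ G)` from it costs no more than building `Tⁿ G` from `G`.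
-/
lemma complexity_iterate_add_le (t : ℝ) (m n : ℕ) :
    complexity G (T.obj^[m + n] G) t ≤
      complexity G (T.obj^[m] G) t * complexity G (T.obj^[n] G) t := by
  rw [Function.iterate_add_apply]
  refine (complexity_le_mul (hG.thick _) (thick_iterate T (hG.thick _) m) t).trans ?_
  gcongr
  exact complexity_iterate_le _ _ T t m

lemma complexity_iterate_le_of_thick {E X : D} (hX : SphericalEntropy.thick E X) (n : ℕ) (t : ℝ) :
    complexity G (T.obj^[n] X) t ≤ complexity G (T.obj^[n] E) t * complexity E X t := by
  refine (complexity_le_mul (hG.thick _) (thick_iterate T hX n) t).trans ?_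
  gcongr
  exact complexity_iterate_le _ _ T t n

/-- Change the generator in each argument in turn; neither factor depends on `n`. -/
lemma complexity_iterate_le_comparable {G' : D} (hG' : IsSplitGenerator G') (n : ℕ) (t : ℝ) :
    complexity G' (T.obj^[n] G') t ≤
      complexity G' G t * complexity G G' t * complexity G (T.obj^[n] G) t := by
  refine (complexity_le_mul (hG'.thick _) (hG.thick _) t).trans ?_
  rw [mul_assoc, mul_comm (complexity G G' t)]
  gcongr
  exact hG.complexity_iterate_le_of_thick (hG.thick _) n t

/-- If `T` acts on a nonzero object `X` as the shift by `m`, the complexity of `Tⁿ G` grows at least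
like `exp (n m t)`. -/
lemma exp_le_complexity_iterate (K : Type w) [Field K] [Linear K D] [IsFiniteType K D] {X : D}
    (hX : ¬ IsZero X) {m : ℤ} (h : Nonempty (T.obj X ≅ X⟦m⟧)) (n : ℕ) (t : ℝ) :
    ENNReal.ofReal (Real.exp (n * (m * t))) ≤ complexity G (T.obj^[n] G) t := by
  obtain ⟨e⟩ := nonempty_iterate_iso_shift h n
  have h₁ : complexity G X t ≤ complexity G X t * (complexity G (T.obj^[n] G) t *
      ENNReal.ofReal (Real.exp (-(n * (m * t))))) := by
    refine (complexity_le_of_shift (m := n * m) (hG.thick X) t).trans ?_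
    rw [← mul_assoc, mul_comm (complexity G X t)]
    push_cast
    rw [mul_assoc (n : ℝ)]
    gcongr
    exact (complexity_le_of_retract G (Retract.ofIso e.symm) t).trans
      (hG.complexity_iterate_le_of_thick (hG.thick X) n t)
  have h₂ := (ENNReal.mul_le_mul_iff_right (complexity_ne_zero K G hX t)
    (complexity_ne_top (hG.thick X) t)).1 ((mul_one _).le.trans h₁)
  rw [Real.exp_neg, ENNReal.ofReal_inv_of_pos (Real.exp_pos _), ← div_eq_mul_inv,
    ENNReal.le_div_iff_mul_le (Or.inl (by simpa using Real.exp_pos _))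
      (Or.inl ENNReal.ofReal_ne_top), one_mul] at h₂
  exact h₂

/-- The limit defining the entropy exists and does not depend on the split-generator, as soon as `T`
acts on some nonzero object as a shift. -/
lemma exists_hasEntropyAt (K : Type w) [Field K] [Linear K D] [IsFiniteType K D] {X : D}
    (hX : ¬ IsZero X) {m : ℤ} (h : Nonempty (T.obj X ≅ X⟦m⟧)) (t : ℝ) :
    ∃ c : ℝ, HasEntropyAt T t c ∧
      Tendsto (fun n : ℕ => Real.log (complexity G (T.obj^[n] G) t).toReal / n) atTop (𝓝 c) := by
  have hne : ∀ {G' : D}, IsSplitGenerator G' → ∀ n, complexity G' (T.obj^[n] G') t ≠ 0 :=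
    fun hG' n h0 => (ENNReal.ofReal_pos.2 (Real.exp_pos _)).ne'
      (le_antisymm ((hG'.exp_le_complexity_iterate K hX h n t).trans h0.le) zero_le)
  have htop : ∀ {G' : D}, IsSplitGenerator G' → ∀ n, complexity G' (T.obj^[n] G') t ≠ ∞ :=
    fun hG' n => complexity_ne_top (hG'.thick _) t
  obtain ⟨c, hc⟩ := exists_tendsto_log_div (hne hG) (htop hG)
    (hG.complexity_iterate_add_le t) (m * t) fun n => hG.exp_le_complexity_iterate K hX h n t
  refine ⟨c, fun G' hG' => tendsto_ennreal_log_div (hne hG') (htop hG') ?_, hc⟩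
  have hC : ∀ {A B : D}, IsSplitGenerator A → IsSplitGenerator B →
      complexity A B t * complexity B A t ≠ ∞ := fun hA hB =>
    ENNReal.mul_ne_top (complexity_ne_top (hA.thick _) t) (complexity_ne_top (hB.thick _) t)
  exact tendsto_log_div_of_comparable (hne hG) (htop hG) (hne hG') (htop hG') (hC hG' hG)
    (hC hG hG') (fun n => hG.complexity_iterate_le_comparable hG' n t)
    (fun n => hG'.complexity_iterate_le_comparable hG n t) hc

/-- If `T G` is an extension of `Z` by `G` with `Z` built from an object `E` on which `T` acts as the
shift by `m`, then the complexity of `Tⁿ G` grows at most like `n exp (n s)`, where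
`s = max 0 (m t)`. -/
lemma complexity_iterate_le_of_triangle {E Z : D} {m : ℤ} (h : Nonempty (T.obj E ≅ E⟦m⟧))
    (hZ : SphericalEntropy.thick E Z) {f : G ⟶ T.obj G} {g : T.obj G ⟶ Z}
    {δ : Z ⟶ G⟦(1 : ℤ)⟧} (hT : Triangle.mk f g δ ∈ distTriang D) {s t : ℝ} (hs : 0 ≤ s)
    (hms : m * t ≤ s) (n : ℕ) :
    complexity G (T.obj^[n] G) t ≤ (1 + n * (complexity G E t * complexity E Z t)) *
      ENNReal.ofReal (Real.exp (n * s)) := by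
  have hE (n : ℕ) : complexity G (T.obj^[n] Z) t ≤
      complexity G E t * complexity E Z t * ENNReal.ofReal (Real.exp (n * s)) := by
    obtain ⟨e⟩ := nonempty_iterate_iso_shift h n
    have hexp : Real.exp (((n * m : ℤ) : ℝ) * t) ≤ Real.exp (n * s) := by
      push_cast
      rw [mul_assoc]
      exact Real.exp_le_exp.2 (mul_le_mul_of_nonneg_left hms n.cast_nonneg)
    refine (hG.complexity_iterate_le_of_thick hZ n t).trans ?_
    rw [mul_right_comm]
    refine mul_le_mul_left ((complexity_le_of_retract G (Retract.ofIso e) t).trans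
      ((complexity_shift_le (hG.thick E) _ t).trans ?_)) _
    gcongr
  induction n with
  | zero => simpa using complexity_self_le G t
  | succ n ih =>
    -- Here `0 ≤ s` is needed: all earlier terms are bounded by the newest exponential.
    have hexp : Real.exp (n * s) ≤ Real.exp ((n + 1 : ℕ) * s) := by
      push_cast
      exact Real.exp_le_exp.2 (by linarith)
    -- Written as `Tⁿ (T G)`, so that `Tⁿ` can be applied to the given triangle.
    rw [Function.iterate_succ_apply]
    refine ((complexity_iterate_le_add G _ hT n t).trans (add_le_add ih (hE n))).trans ?_
    rw [← add_mul, Nat.cast_add, Nat.cast_one, add_mul (n : ℝ≥0∞), one_mul, ← add_assoc]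
    gcongr

end IsSplitGenerator

end Entropy

end SphericalEntropy

/-! ### The entropy of the spherical twist -/

theorem proposition5p3
    {K : Type*} [Field K]
    {D : Type*} [Category* D] [HasZeroObject D] [HasShift D ℤ] [Preadditive D]
    [∀ n : ℤ, (shiftFunctor D n).Additive] [Pretriangulated D] [IsTriangulated D]
    [Linear K D] [∀ n : ℤ, (shiftFunctor D n).Linear K]
    [SphericalEntropy.IsFiniteType K D]
    (hD : ∃ G : D, SphericalEntropy.IsSplitGenerator G)
    (E : D) (d : ℤ) (hE : SphericalEntropy.IsSpherical K E d)
    (T : D ⥤ D) [T.CommShift ℤ] [T.IsTriangulated]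
    (hT : SphericalEntropy.IsSphericalTwist K E T) :
    ∃ h : ℝ → EReal,
      (∀ t : ℝ, SphericalEntropy.HasEntropyAt T t (h t)) ∧
      (∀ t : ℝ, (((1 - (d : ℝ)) * t : ℝ) : EReal) ≤ h t) ∧
      (∀ t : ℝ, 0 ≤ t → h t ≤ 0) ∧
      (∀ t : ℝ, t ≤ 0 → h t ≤ (((1 - (d : ℝ)) * t : ℝ) : EReal)) ∧
      (SphericalEntropy.HasNonzeroRightOrthogonal E → ∀ t : ℝ, 0 ≤ t → h t = 0) := by
  open SphericalEntropy in
  obtain ⟨G, hG⟩ := hD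
  have hTE := hE.nonempty_iso_shift hT
  have hE0 := hE.not_isZero
  have hd : (1 : ℝ) ≤ d := by exact_mod_cast hE.pos
  choose c hent hlim using hG.exists_hasEntropyAt K hE0 hTE
  have hne (t : ℝ) (n : ℕ) : complexity G (T.obj^[n] G) t ≠ 0 := fun h0 =>
    (ENNReal.ofReal_pos.2 (Real.exp_pos _)).ne'
      (le_antisymm ((hG.exp_le_complexity_iterate K hE0 hTE n t).trans h0.le) zero_le)
  have htop (t : ℝ) (n : ℕ) : complexity G (T.obj^[n] G) t ≠ ∞ :=
    complexity_ne_top (hG.thick _) t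
  have hlow {X : D} (hX : ¬ IsZero X) {m : ℤ} (h : Nonempty (T.obj X ≅ X⟦m⟧)) (t : ℝ) :
      m * t ≤ c t :=
    le_of_tendsto_log_div (htop t) (hlim t) fun n => hG.exp_le_complexity_iterate K hX h n t
  -- Used with `s = 0` for `t ≥ 0` and with `s = (1 - d) t` for `t ≤ 0`; both are admissible because
  -- `d ≥ 1`.
  have hupp (t s : ℝ) (hs : 0 ≤ s) (hds : (1 - (d : ℝ)) * t ≤ s) : c t ≤ s := by
    obtain ⟨p, q, hpq⟩ := hT G
    have hZ : thick E ((homTensor K E G)⟦(1 : ℤ)⟧) :=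
      thick_shift (thick_biproduct fun j => ⟨_, (built_self E).shift _⟩) 1
    exact tendsto_log_div_le (hne t)
      (ENNReal.mul_ne_top (complexity_ne_top (hG.thick E) t) (complexity_ne_top hZ t)) (hlim t)
      (hG.complexity_iterate_le_of_triangle hTE hZ (rot_of_distTriang _ hpq) hs
        (by push_cast; exact hds))
  have hneg (t : ℝ) (ht : 0 ≤ t) : c t ≤ 0 :=
    hupp t 0 le_rfl (mul_nonpos_of_nonpos_of_nonneg (by linarith) ht)
  refine ⟨fun t => c t, hent, fun t => ?_, fun t ht => ?_, fun t ht => ?_, ?_⟩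
  · exact EReal.coe_le_coe_iff.2 (by simpa using hlow hE0 hTE t)
  · exact EReal.coe_le_coe_iff.2 (hneg t ht)
  · exact EReal.coe_le_coe_iff.2
      (hupp t _ (mul_nonneg_of_nonpos_of_nonpos (by linarith) ht) le_rfl)
  · rintro ⟨F, hF, hEF⟩ t ht
    have h := hlow hF (hT.nonempty_iso_of_orthogonal hEF) t
    rw [Int.cast_zero, zero_mul] at h
    exact EReal.coe_eq_zero.2 (le_antisymm (hneg t ht) h)
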